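/- Let $\mathcal S$ be a non-empty semigroup equipped with a topology (not necessarily Hausdorff; no compatibility between multiplication and topology is assumed). For $f:\mathcal S\to\mathbb R$ and $s\in\mathcal S$ put $f_s(t)=f(ts)$. Let $C_r(\mathcal S)$ be the space, with the sup-norm, of all bounded continuous $f:\mathcal S\to\mathbb R$ such that $f_s$ is continuous for every $s\in\mathcal S$. Let $C_{norm}(\mathcal S)$ [resp. $C_{weak}(\mathcal S)$] be the space of all $f\in C_r(\mathcal S)$ such that the maps $s\mapsto f_s$ and $s\mapsto f_{st}$ ($t\in\mathcal S$) from $\mathcal S$ to $C_r(\mathcal S)$ are continuous for the norm [resp. weak] topology of $C_r(\mathcal S)$. A right invariant mean on one of these two spaces is a linear functional $\phi$ on it with $\inf f(\mathcal S)\le\phi(f)\le\sup f(\mathcal S)$ and $\phi(f_s)=\phi(f)$ for all $f$ in the space and all $s\in\mathcal S$. Call $\mathcal S$ weakly [resp. strongly] right amenable if there is a right invariant mean on $C_{norm}(\mathcal S)$ [resp. $C_{weak}(\mathcal S)$]. Let $X$ and $Y$ be Banach spaces, both real or both complex, and let $s\mapsto A_s\in\mathcal L(X)$ and $s\mapsto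 B_s\in\mathcal L(Y)$ be homomorphisms (that is, $A_{st}=A_sA_t$ and $B_{st}=B_sB_t$ for all $s,t\in\mathcal S$). Let $E$ be a closed linear subspace of $X$ and $T_0:E\to Y$ a bounded linear operator. Suppose that: - (i0) either $\mathcal S$ is strongly right amenable and $s\mapsto A_s$, $s\mapsto B_s$ are continuous in the strong operator topologies, or $\mathcal S$ is weakly right amenable and $s\mapsto A_s$, $s\mapsto B_s$ are continuous in the operator norm topologies; - (i1) for every $s\in\mathcal S$, $A_s(E)\subset E$ and $B_s$ is an isomorphism (a linear homeomorphism of $Y$ onto $Y$); - (i2) $Y$ is a dual Banach space, that is, there is a linear isometry of $Y$ onto the dual $Z^*$ of a Banach space $Z$; fix one and call the topology that it carries over to $Y$ from the weak* topology of $Z^*$ the weak* topology of $Y$; - (i3) for every $s\in\mathcal S$, $B_s$ is weak* continuous on the closed unit ball of $Y$; - (i4) the function $s\mapsto\|B_s^{-1}\|$ is locally bounded on $\mathcal S$; - (i5) $B_sT_0x=T_0A_sx$ for all $s\in\mathcal S$ and $x\in E$. Then the following conditions are equivalent: - (i) $T_0$ extends to a bounded linear operator $T:X\to Y$ such that $B_sT=TA_s$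 for all $s\in\mathcal S$; - (ii) there is a bounded linear operator $T':X\to Y$ that extends $T_0$ and satisfies $\sup_{s\in\mathcal S}\|B_s^{-1}T'A_s\|<\infty$. -/

import Mathlib

open scoped BoundedContinuousFunction Topology

noncomputable section

namespace SGT

/-! A semigroup with topology is a type `S` with `[Semigroup S] [TopologicalSpace S]`; no
compatibility between the multiplication and the topology is assumed. -/

section Amenability

variable (S : Type*) [Semigroup S] [TopologicalSpace S]

/-- The space `C_r(S)` of all bounded continuous `f : S → ℝ` such that each right translate
`t ↦ f (t * s)` is continuous, with the sup-norm. -/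
def Cr : Submodule ℝ (S →ᵇ ℝ) where
  carrier := {f | ∀ s : S, Continuous fun t => f (t * s)}
  zero_mem' := fun _ => continuous_const
  add_mem' := fun hf hg s => (hf s).add (hg s)
  smul_mem' := fun c _ hf s => (hf s).const_smul c

instance instContinuousAddCr : ContinuousAdd (Cr S) :=
  (inferInstance : IsTopologicalAddGroup (Cr S)).toContinuousAdd

variable {S}

/-- The right translate `f_s`, given by `f_s t = f (t * s)`, as a linear operator on `C_r(S)`. -/
def rightTranslate (s : S) : Cr S →ₗ[ℝ] Cr S where
  toFun f :=
    ⟨BoundedContinuousFunction.ofNormedAddCommGroup (fun t => f.1 (t * s)) (f.2 s) ‖f.1‖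
        (fun t => f.1.norm_coe_le_norm (t * s)),
      fun r => by
        have h := f.2 (r * s)
        simpa [mul_assoc] using h⟩
  map_add' _ _ := rfl
  map_smul' _ _ := rfl

@[simp]
theorem rightTranslate_apply (s : S) (f : Cr S) (t : S) :
    (rightTranslate s f).1 t = f.1 (t * s) := rfl

theorem rightTranslate_rightTranslate (s r : S) (f : Cr S) :
    rightTranslate s (rightTranslate r f) = rightTranslate (s * r) f := by
  apply Subtype.ext
  ext t
  simp [mul_assoc]

/-- A linear subspace of `C_r(S)` is right invariant if it contains all right translates of its
members. -/
def RightInvariant (F : Submodule ℝ (Cr S)) : Prop :=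
  ∀ f ∈ F, ∀ s : S, rightTranslate s f ∈ F

/-- A mean on `F`: a linear functional with `inf f(S) ≤ φ f ≤ sup f(S)`. -/
def IsMean (F : Submodule ℝ (Cr S)) (φ : F →ₗ[ℝ] ℝ) : Prop :=
  ∀ f : F, (⨅ s : S, f.1.1 s) ≤ φ f ∧ φ f ≤ ⨆ s : S, f.1.1 s

/-- A right invariant mean on a right invariant linear subspace of `C_r(S)`. -/
def IsRightInvariantMean (F : Submodule ℝ (Cr S)) (hF : RightInvariant F) (φ : F →ₗ[ℝ] ℝ) :
    Prop :=
  IsMean F φ ∧ ∀ (f : F) (s : S), φ ⟨rightTranslate s f.1, hF f.1 f.2 s⟩ = φ f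

variable (S)

/-- `C_norm(S)`: those `f` in `C_r(S)` for which `s ↦ f_s` and all `s ↦ f_{st}` are continuous
into `C_r(S)` with the norm topology. -/
def CNorm : Submodule ℝ (Cr S) where
  carrier := {f | (Continuous fun s : S => rightTranslate s f) ∧
    ∀ t : S, Continuous fun s : S => rightTranslate (s * t) f}
  zero_mem' := by simp [continuous_const]
  add_mem' := fun {f g} hf hg => by
    simp only [Set.mem_ofPred_eq, map_add] at *
    exact ⟨hf.1.add hg.1, fun t => (hf.2 t).add (hg.2 t)⟩
  smul_mem' := fun c f hf => by
    simp only [Set.mem_ofPred_eq, map_smul] at *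
    exact ⟨hf.1.const_smul c, fun t => (hf.2 t).const_smul c⟩

/-- `C_weak(S)`: those `f` in `C_r(S)` for which `s ↦ f_s` and all `s ↦ f_{st}` are continuous
into `C_r(S)` with the weak topology of the normed space `C_r(S)`. -/
def CWeak : Submodule ℝ (Cr S) where
  carrier := {f | (Continuous fun s : S => toWeakSpace ℝ (Cr S) (rightTranslate s f)) ∧
    ∀ t : S, Continuous fun s : S => toWeakSpace ℝ (Cr S) (rightTranslate (s * t) f)}
  zero_mem' := by simp [continuous_const]
  add_mem' := fun {f g} hf hg => by
    simp only [Set.mem_ofPred_eq, map_add] at *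
    exact ⟨hf.1.add hg.1, fun t => (hf.2 t).add (hg.2 t)⟩
  smul_mem' := fun c f hf => by
    simp only [Set.mem_ofPred_eq, map_smul] at *
    exact ⟨hf.1.const_smul c, fun t => (hf.2 t).const_smul c⟩

theorem rightInvariant_CNorm : RightInvariant (CNorm S) := by
  intro f hf r
  refine ⟨?_, fun t => ?_⟩
  · simpa only [rightTranslate_rightTranslate] using hf.2 r
  · simpa only [rightTranslate_rightTranslate, mul_assoc] using hf.2 (t * r)

theorem rightInvariant_CWeak : RightInvariant (CWeak S) := by
  intro f hf r
  refine ⟨?_, fun t => ?_⟩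
  · simpa only [rightTranslate_rightTranslate] using hf.2 r
  · simpa only [rightTranslate_rightTranslate, mul_assoc] using hf.2 (t * r)

/-- Weak right amenability: there is a right invariant mean on `C_norm(S)`. -/
def WeaklyRightAmenable : Prop :=
  ∃ φ : CNorm S →ₗ[ℝ] ℝ, IsRightInvariantMean (CNorm S) (rightInvariant_CNorm S) φ

/-- Strong right amenability: there is a right invariant mean on `C_weak(S)`. -/
def StronglyRightAmenable : Prop :=
  ∃ φ : CWeak S →ₗ[ℝ] ℝ, IsRightInvariantMean (CWeak S) (rightInvariant_CWeak S) φ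

end Amenability

section Operators

variable {𝕜 : Type*} [RCLike 𝕜]

/-- Continuity of an operator-valued function in the strong operator topology. -/
def SOTContinuous {S X : Type*} [TopologicalSpace S] [NormedAddCommGroup X] [NormedSpace 𝕜 X]
    (A : S → X →L[𝕜] X) : Prop :=
  ∀ x : X, Continuous fun s => A s x

/-- A real function is locally bounded if each point has a neighbourhood on which it is bounded. -/
def LocallyBounded {S : Type*} [TopologicalSpace S] (g : S → ℝ) : Prop :=
  ∀ s : S, ∃ U ∈ 𝓝 s, ∃ C : ℝ, ∀ t ∈ U, |g t| ≤ C

/-- The weak* topology on a dual Banach space `Y`, that is, on a space `Y` with a linear isometry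
`ι` onto the dual of `Z`: the topology carried over by `ι` from the weak* topology of the dual. -/
abbrev weakStarTopology {Y Z : Type*} [NormedAddCommGroup Y] [NormedSpace 𝕜 Y]
    [NormedAddCommGroup Z] [NormedSpace 𝕜 Z] (ι : Y ≃ₗᵢ[𝕜] StrongDual 𝕜 Z) :
    TopologicalSpace Y :=
  TopologicalSpace.induced (fun y => (StrongDual.toWeakDual (ι y) : WeakDual 𝕜 Z)) inferInstance

/-- The operator `B` is weak* continuous on the closed unit ball of `Y`. -/
def WeakStarContinuousOnBall {Y Z : Type*} [NormedAddCommGroup Y] [NormedSpace 𝕜 Y]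
    [NormedAddCommGroup Z] [NormedSpace 𝕜 Z] (ι : Y ≃ₗᵢ[𝕜] StrongDual 𝕜 Z)
    (B : Y →L[𝕜] Y) : Prop :=
  @ContinuousOn Y Y (weakStarTopology ι) (weakStarTopology ι) B (Metric.closedBall 0 1)

end Operators

end SGT

end

namespace SGT

open Filter

/-! ### Norm estimates for the pairing of `Y` with its predual. -/

section Estimates

variable {𝕜 : Type*} [RCLike 𝕜] {X : Type*} [NormedAddCommGroup X] [NormedSpace 𝕜 X]
  {Y : Type*} [NormedAddCommGroup Y] [NormedSpace 𝕜 Y]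
  {Z : Type*} [NormedAddCommGroup Z] [NormedSpace 𝕜 Z] (ι : Y ≃ₗᵢ[𝕜] StrongDual 𝕜 Z)

/-! If `T` intertwines, then `B_s⁻¹ T A_s = T`, so `T' = T` is admissible. Conversely, the bounded
family `G_s = B_s⁻¹ T' A_s` is averaged: with an invariant mean `φ`, define `T` by `Re ⟨T x, z⟩ = φ
(s ↦ Re ⟨G_s x, z⟩)` (`exists_average`). On `E` the family is constantly `T₀`, hence so is its
average.

For the intertwining relation, `G_{ts} = B_s⁻¹ G_t A_s`. If `D_s` is the preadjoint of `B_s⁻¹`,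
translating the coefficient of `(x, z)` by `s` gives the coefficient of `(A_s x, D_s z)`
(`rightTranslate_eq`). Invariance of `φ` then reads `B_s⁻¹ T A_s = T`.

What remains is that `D_s` exists (`exists_preadjoint_inverse`) and that the coefficients lie in the
domain of the mean (`mem_CNorm`, `mem_CWeak`). -/

theorem abs_re_apply_le {G : X →L[𝕜] Y} {M : ℝ} (hM : ‖G‖ ≤ M) (x : X) (z : Z) :
    |RCLike.re (ι (G x) z)| ≤ M * ‖x‖ * ‖z‖ :=
  calc |RCLike.re (ι (G x) z)| ≤ ‖ι (G x) z‖ := RCLike.abs_re_le_norm _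
    _ ≤ ‖ι (G x)‖ * ‖z‖ := (ι (G x)).le_opNorm z
    _ ≤ M * ‖x‖ * ‖z‖ := by
      rw [ι.norm_map]
      gcongr
      exact G.le_of_opNorm_le hM x

/-- Stated for single vectors, so that it applies to preadjoints not yet known to be linear, and to
differences. -/
theorem norm_preadjoint_le (R : Y →L[𝕜] Y) (z w : Z) (h : ∀ y, ι (R y) z = ι y w) :
    ‖w‖ ≤ ‖R‖ * ‖z‖ := by
  refine NormedSpace.norm_le_dual_bound 𝕜 _ (by positivity) fun g => ?_
  obtain ⟨y, rfl⟩ := ι.surjective g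
  rw [← h, ι.norm_map]
  calc ‖ι (R y) z‖ ≤ ‖ι (R y)‖ * ‖z‖ := (ι (R y)).le_opNorm z
    _ ≤ ‖R‖ * ‖y‖ * ‖z‖ := by
      rw [ι.norm_map]
      gcongr
      exact R.le_opNorm y
    _ = _ := by ring

end Estimates

/-! ### Real parts of functionals, and preadjoints. -/

section Duality

variable {𝕜 : Type*} [RCLike 𝕜] {Z : Type*} [NormedAddCommGroup Z] [NormedSpace 𝕜 Z]

/-- A bounded real-linear functional on a `𝕜`-normed space is the real part of a bounded
`𝕜`-linear functional with the same bound. -/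
theorem exists_strongDual_re_eq (u : Z → ℝ) (hadd : ∀ z w, u (z + w) = u z + u w)
    (hsmul : ∀ (c : ℝ) z, u ((c : 𝕜) • z) = c * u z) (C : ℝ) (hC : 0 ≤ C)
    (hu : ∀ z, |u z| ≤ C * ‖z‖) :
    ∃ h : StrongDual 𝕜 Z, (∀ z, RCLike.re (h z) = u z) ∧ ‖h‖ ≤ C := by
  let _ : NormedSpace ℝ Z := NormedSpace.restrictScalars ℝ 𝕜 Z
  have : IsScalarTower ℝ 𝕜 Z := ⟨fun c a z => by
    change (c • a) • z = (algebraMap ℝ 𝕜 c) • a • z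
    rw [smul_smul, Algebra.smul_def]⟩
  let v : Z →ₗ[ℝ] ℝ :=
    { toFun := u
      map_add' := hadd
      map_smul' := fun c z => hsmul c z }
  let w : StrongDual ℝ Z := v.mkContinuous C hu
  refine ⟨w.extendRCLike, fun z => Module.Dual.re_extendRCLike_apply _ z, ?_⟩
  rw [StrongDual.norm_extendRCLike]
  exact v.mkContinuous_norm_le hC hu

/-- Two bounded functionals with the same real part agree. -/
theorem strongDual_ext_re {g h : StrongDual 𝕜 Z}
    (H : ∀ z, RCLike.re (g z) = RCLike.re (h z)) : g = h := by
  ext z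
  apply RCLike.ext (H z)
  have := H ((RCLike.I : 𝕜) • z)
  simp only [map_smul, smul_eq_mul, RCLike.I_mul_re] at this
  linarith

/-- A functional on the dual of a Banach space which on the unit ball is small on the annihilators
of finite sets is an evaluation. -/
theorem exists_eval_of_small_on_annihilators [CompleteSpace Z]
    (f : StrongDual 𝕜 (StrongDual 𝕜 Z))
    (hf : ∀ ε > 0, ∃ F : Finset Z, ∀ w : StrongDual 𝕜 Z, ‖w‖ ≤ 1 → (∀ z ∈ F, w z = 0) →
      ‖f w‖ ≤ ε) :
    ∃ z : Z, ∀ w, f w = w z := by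
  let J := NormedSpace.inclusionInDoubleDualLi (E := Z) 𝕜
  have hcl : IsClosed (Set.range J) := 
    J.antilipschitz.isClosed_range (f := J) J.isometry.uniformContinuous
  suffices hmem : f ∈ Set.range J by
    obtain ⟨z, rfl⟩ := hmem
    exact ⟨z, fun w => rfl⟩
  refine hcl.closure_subset ((Metric.mem_closure_iff
    (α := StrongDual 𝕜 (StrongDual 𝕜 Z))).2 fun ε hε => ?_)
  obtain ⟨F, hF⟩ := hf (ε / 2) (half_pos hε)
  let L : F → StrongDual 𝕜 Z →ₗ[𝕜] 𝕜 := fun z => (J z).toLinearMap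
  let M : Subspace 𝕜 (StrongDual 𝕜 Z) := ⨅ i, LinearMap.ker (L i)
  have hM : ∀ w, w ∈ M ↔ ∀ z ∈ F, w z = 0 := fun w => by
    simp only [M, Submodule.mem_iInf, LinearMap.mem_ker]
    exact ⟨fun h z hz => h ⟨z, hz⟩, fun h i => h i.1 i.2⟩
  -- Hahn–Banach: `h` agrees with `f` on the annihilator `M` of `F` and has norm at most `ε / 2`. So
  -- `f - h` vanishes on `M`, is a combination of evaluations at points of `F`, and is close to `f`.
  obtain ⟨h, hh, hnorm⟩ := exists_extension_norm_eq M (f.comp M.subtypeL)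
  have hle : ‖h‖ ≤ ε / 2 := by
    rw [hnorm]
    refine ContinuousLinearMap.opNorm_le_of_unit_norm (half_pos hε).le fun w hw => ?_
    exact hF w hw.le ((hM w).1 w.2)
  have hspan : (f - h).toLinearMap ∈ Submodule.span 𝕜 (Set.range L) := by
    refine mem_span_of_iInf_ker_le_ker fun w hw => ?_
    have := hh ⟨w, hw⟩
    simp only [LinearMap.mem_ker]
    simpa [sub_eq_zero] using this.symm
  have hrange : Submodule.span 𝕜 (Set.range L) ≤
      (LinearMap.range J.toLinearMap).map (ContinuousLinearMap.coeLM 𝕜) := by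
    rw [Submodule.span_le]
    rintro _ ⟨i, rfl⟩
    exact ⟨J i, ⟨i, rfl⟩, rfl⟩
  obtain ⟨_, ⟨z, rfl⟩, hz⟩ := hrange hspan
  refine ⟨J z, ⟨z, rfl⟩, ?_⟩
  have hz' : J z = f - h := ContinuousLinearMap.coe_injective hz
  rw [hz']
  refine (dist_eq_norm (E := StrongDual 𝕜 (StrongDual 𝕜 Z)) f (f - h)).trans_lt ?_
  refine (congrArg norm (sub_sub_cancel f h)).trans_lt ?_
  linarith

variable {Y : Type*} [NormedAddCommGroup Y] [NormedSpace 𝕜 Y]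

/-- An operator on a dual Banach space that is weak* continuous on the unit ball is an adjoint. -/
theorem exists_preadjoint [CompleteSpace Z] (ι : Y ≃ₗᵢ[𝕜] StrongDual 𝕜 Z) (B : Y →L[𝕜] Y)
    (hB : WeakStarContinuousOnBall ι B) : ∃ C : Z → Z, ∀ y z, ι (B y) z = ι y (C z) := by
  suffices H : ∀ z, ∃ c, ∀ y, ι (B y) z = ι y c by
    choose C hC using H
    exact ⟨C, fun y z => hC z y⟩
  intro z
  let e : StrongDual 𝕜 Z →L[𝕜] Y := (ι.symm : StrongDual 𝕜 Z ≃L[𝕜] Y)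
  let i : Y →L[𝕜] StrongDual 𝕜 Z := (ι : Y ≃L[𝕜] StrongDual 𝕜 Z)
  let f : StrongDual 𝕜 (StrongDual 𝕜 Z) :=
    (NormedSpace.inclusionInDoubleDual 𝕜 Z z) ∘L i ∘L B ∘L e
  have hf : ∀ y, f (ι y) = ι (B y) z := fun y => by
    change ι (B (ι.symm (ι y))) z = _
    rw [ι.symm_apply_apply]
  obtain ⟨c, hc⟩ := exists_eval_of_small_on_annihilators f fun ε hε => by
    let V : Set Y := {y | ‖ι y z‖ < ε}
    have hV : IsOpen[weakStarTopology ι] V := by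
      refine ⟨{w : WeakDual 𝕜 Z | ‖w z‖ < ε}, ?_, rfl⟩
      exact isOpen_lt (WeakDual.eval_continuous z).norm continuous_const
    obtain ⟨U, hU, hUV⟩ := (@continuousOn_iff' _ _ (weakStarTopology ι) (weakStarTopology ι) _ _).1
      hB V hV
    obtain ⟨W, hW, rfl⟩ := hU
    obtain ⟨W', hW', rfl⟩ := hW
    have h0 : (0 : Y) ∈ B ⁻¹' V ∩ Metric.closedBall 0 1 := by simp [V, hε]
    rw [hUV] at h0
    -- A basic weak* neighbourhood of `0` restricts only finitely many coordinates, so it contains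
    -- every functional vanishing on them.
    obtain ⟨F, u, hu, hsub⟩ := isOpen_pi_iff.1 hW' _ h0.1
    refine ⟨F, fun w hw hwF => ?_⟩
    obtain ⟨y, rfl⟩ := ι.surjective w
    rw [hf]
    have hy : y ∈ B ⁻¹' V ∩ Metric.closedBall 0 1 := by
      rw [hUV]
      refine ⟨hsub fun a ha => ?_, by simpa using hw⟩
      have h1 := (hu a ha).2
      change ι 0 a ∈ u a at h1
      change ι y a ∈ u a
      rw [hwF a ha]
      simpa using h1
    exact le_of_lt hy.1
  exact ⟨c, fun y => by rw [← hf, hc]⟩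

/-- The inverse of an invertible adjoint operator is an adjoint operator. -/
theorem exists_preadjoint_inverse [CompleteSpace Z] (ι : Y ≃ₗᵢ[𝕜] StrongDual 𝕜 Z)
    (B : Y →L[𝕜] Y) (hB : WeakStarContinuousOnBall ι B) (hinv : B.IsInvertible) :
    ∃ D : Z → Z, ∀ y z, ι (B.inverse y) z = ι y (D z) := by
  obtain ⟨C, hC⟩ := exists_preadjoint ι B hB
  obtain ⟨e, rfl⟩ := hinv
  rw [ContinuousLinearMap.inverse_equiv]
  simp only [ContinuousLinearEquiv.coe_coe] at *
  have hext : ∀ z w : Z, (∀ y, ι y z = ι y w) → z = w := fun z w h =>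
    (SeparatingDual.eq_iff_forall_dual_eq (R := 𝕜)).2 fun g => by
      obtain ⟨y, rfl⟩ := ι.surjective g
      exact h y
  let C' : Z →ₗ[𝕜] Z :=
    { toFun := C
      map_add' := fun z w => hext _ _ fun y => by simp [← hC]
      map_smul' := fun c z => hext _ _ fun y => by simp [← hC] }
  -- `C'` is bounded below because its adjoint `e` is invertible; hence its range is closed.
  have hbd : ∀ z, ‖z‖ ≤ ‖(e.symm : Y →L[𝕜] Y)‖ * ‖C' z‖ := fun z =>
    norm_preadjoint_le ι (e.symm : Y →L[𝕜] Y) (C z) z fun y => by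
      rw [← hC, ContinuousLinearEquiv.coe_coe, e.apply_symm_apply]
  have hcont : ∀ z, ‖C' z‖ ≤ ‖(e : Y →L[𝕜] Y)‖ * ‖z‖ := fun z =>
    norm_preadjoint_le ι (e : Y →L[𝕜] Y) z (C z) fun y => hC y z
  let Cc : Z →L[𝕜] Z := C'.mkContinuous _ hcont
  have hanti : AntilipschitzWith ‖(e.symm : Y →L[𝕜] Y)‖₊ Cc :=
    AddMonoidHomClass.antilipschitz_of_bound Cc hbd
  have hclosed : IsClosed (Set.range Cc) := hanti.isClosed_range Cc.uniformContinuous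
  have hsurj : ∀ z, ∃ w, C w = z := fun z => by
    let N : Submodule 𝕜 Z := LinearMap.range C'
    have hN : IsClosed (N : Set Z) := by
      rw [LinearMap.coe_range]
      exact hclosed
    suffices hz : z ∈ N from hz
    rw [← Submodule.Quotient.mk_eq_zero N]
    -- The range is everything: a functional killing it is some `y` with `e y = 0`.
    refine SeparatingDual.eq_zero_of_forall_dual_eq_zero (R := 𝕜) fun g => ?_
    obtain ⟨y, hy⟩ := ι.surjective (g ∘L N.mkQL)
    have hval : ∀ w, ι y w = g (N.mkQ w) := fun w => by rw [hy]; rfl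
    have hy0 : e y = 0 := by
      apply ι.injective
      ext w
      have : N.mkQ (C w) = 0 := (Submodule.Quotient.mk_eq_zero N).2 ⟨w, rfl⟩
      rw [hC, hval, this]
      simp
    have hy1 : y = 0 := by simpa using hy0
    have := hval z
    rw [hy1] at this
    simpa using this.symm
  choose D hD using hsurj
  exact ⟨D, fun y z => by rw [← e.apply_symm_apply y, hC, hD, e.apply_symm_apply]⟩

end Duality

/-! ### Bounds for means. -/

section Means

variable {S : Type*} [Semigroup S] [TopologicalSpace S] [Nonempty S]
  {F : Submodule ℝ (Cr S)} {φ : F →ₗ[ℝ] ℝ}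

theorem IsMean.abs_apply_le (hφ : IsMean F φ) (f : F) (C : ℝ) (hf : ∀ s, |f.1.1 s| ≤ C) :
    |φ f| ≤ C :=
  abs_le.2 ⟨(le_ciInf fun s => (abs_le.1 (hf s)).1).trans (hφ f).1,
    (hφ f).2.trans (ciSup_le fun s => (abs_le.1 (hf s)).2)⟩

theorem IsMean.eq_of_forall_eq (hφ : IsMean F φ) (f : F) (c : ℝ) (hf : ∀ s, f.1.1 s = c) :
    φ f = c :=
  le_antisymm ((hφ f).2.trans (ciSup_le fun s => (hf s).le))
    ((le_ciInf fun s => (hf s).ge).trans (hφ f).1)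

end Means

/-! ### Continuity of inverses and of their preadjoints. -/

section Inverses

variable {𝕜 : Type*} [RCLike 𝕜] {S : Type*} [TopologicalSpace S]
  {Y : Type*} [NormedAddCommGroup Y] [NormedSpace 𝕜 Y]

theorem LocallyBounded.exists_eventually_norm_le {g : S → ℝ} (hg : LocallyBounded g) (s : S) :
    ∃ C, ∀ᶠ t in 𝓝 s, g t ≤ C := by
  obtain ⟨U, hU, C, hC⟩ := hg s
  exact ⟨C, mem_of_superset hU fun t ht => (le_abs_self _).trans (hC t ht)⟩

/-- Rests on `R_s v_s - R_a v_a = R_s (v_s - B_s R_a v_a)` with `‖R_s‖` bounded near `a`. -/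
theorem continuous_inverse_apply {B R : S → Y →L[𝕜] Y} (hB : SOTContinuous B)
    (hRB : ∀ s y, R s (B s y) = y) (hBR : ∀ s y, B s (R s y) = y)
    (hR : LocallyBounded fun s => ‖R s‖) {v : S → Y} (hv : Continuous v) :
    Continuous fun s => R s (v s) := by
  refine continuous_iff_continuousAt.2 fun a => tendsto_iff_norm_sub_tendsto_zero.2 ?_
  obtain ⟨C, hC⟩ := hR.exists_eventually_norm_le a
  have hlim : Tendsto (fun s => C * ‖v s - B s (R a (v a))‖) (𝓝 a) (𝓝 0) := by
    have : Continuous fun s => C * ‖v s - B s (R a (v a))‖ :=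
      continuous_const.mul (hv.sub (hB _)).norm
    simpa [hBR] using this.tendsto a
  refine squeeze_zero' (Eventually.of_forall fun _ => norm_nonneg _) ?_ hlim
  filter_upwards [hC] with s hs
  have : R s (v s) - R a (v a) = R s (v s - B s (R a (v a))) := by rw [map_sub, hRB]
  rw [this]
  exact (R s).le_of_opNorm_le hs _

/-- Resolvent identity: `R_s - R_a = R_s (B_a - B_s) R_a`. -/
theorem continuous_inverse {B R : S → Y →L[𝕜] Y} (hB : Continuous B)
    (hRB : ∀ s y, R s (B s y) = y) (hBR : ∀ s y, B s (R s y) = y)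
    (hR : LocallyBounded fun s => ‖R s‖) : Continuous R := by
  refine continuous_iff_continuousAt.2 fun a => tendsto_iff_norm_sub_tendsto_zero.2 ?_
  obtain ⟨C, hC⟩ := hR.exists_eventually_norm_le a
  have hlim : Tendsto (fun s => C * (‖B a - B s‖ * ‖R a‖)) (𝓝 a) (𝓝 0) := by
    have : Continuous fun s => C * (‖B a - B s‖ * ‖R a‖) := by fun_prop
    simpa using this.tendsto a
  refine squeeze_zero' (Eventually.of_forall fun _ => norm_nonneg _) ?_ hlim
  filter_upwards [hC] with s hs
  have : R s - R a = R s ∘L (B a - B s) ∘L R a := by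
    ext y
    simp [hRB, hBR]
  rw [this]
  exact (ContinuousLinearMap.opNorm_comp_le _ _).trans
    (mul_le_mul hs (ContinuousLinearMap.opNorm_comp_le _ _) (norm_nonneg _)
      ((norm_nonneg _).trans hs))

theorem continuous_preadjoint {Z : Type*} [NormedAddCommGroup Z] [NormedSpace 𝕜 Z]
    (ι : Y ≃ₗᵢ[𝕜] StrongDual 𝕜 Z) {R : S → Y →L[𝕜] Y} {D : S → Z → Z}
    (hD : ∀ s y z, ι (R s y) z = ι y (D s z)) (hR : Continuous R) (z : Z) : Continuous fun s => D s z := by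
  refine continuous_iff_continuousAt.2 fun a => tendsto_iff_norm_sub_tendsto_zero.2 ?_
  have hlim : Tendsto (fun s => ‖R s - R a‖ * ‖z‖) (𝓝 a) (𝓝 0) := by
    have : Continuous fun s => ‖R s - R a‖ * ‖z‖ := by fun_prop
    simpa using this.tendsto a
  refine squeeze_zero (fun _ => norm_nonneg _) (fun s => ?_) hlim
  exact norm_preadjoint_le ι (R s - R a) z (D s z - D a z) fun y => by simp [← hD]

end Inverses

/-! ### Coefficients of the operator family and their average. -/

section Coefficients

variable {𝕜 : Type*} [RCLike 𝕜] {S : Type*} [Semigroup S] [TopologicalSpace S]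
  {X : Type*} [NormedAddCommGroup X] [NormedSpace 𝕜 X]
  {Y : Type*} [NormedAddCommGroup Y] [NormedSpace 𝕜 Y]
  {Z : Type*} [NormedAddCommGroup Z] [NormedSpace 𝕜 Z]

/-- `f x z` is the real part of the coefficient `s ↦ ⟨G s x, z⟩` of the operator family `G`. -/
def IsCoefficient (ι : Y ≃ₗᵢ[𝕜] StrongDual 𝕜 Z) (G : S → X →L[𝕜] Y) (f : X → Z → Cr S) : Prop :=
  ∀ x z s, (f x z).1 s = RCLike.re (ι (G s x) z)

variable {ι : Y ≃ₗᵢ[𝕜] StrongDual 𝕜 Z} {G : S → X →L[𝕜] Y} {M : ℝ}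

theorem exists_isCoefficient (ι : Y ≃ₗᵢ[𝕜] StrongDual 𝕜 Z) (hM : ∀ s, ‖G s‖ ≤ M)
    (hG : ∀ x, Continuous fun s => G s x) (hGr : ∀ s x, Continuous fun t => G (t * s) x) :
    ∃ f : X → Z → Cr S, IsCoefficient ι G f := by
  have key : ∀ (z : Z) (v : S → Y), Continuous v → Continuous fun s => RCLike.re (ι (v s) z) :=
    fun z v hv => RCLike.continuous_re.comp
      ((ContinuousLinearMap.apply 𝕜 𝕜 z).continuous.comp (ι.continuous.comp hv))
  exact ⟨fun x z => ⟨BoundedContinuousFunction.ofNormedAddCommGroup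
    (fun s => RCLike.re (ι (G s x) z)) (key z _ (hG x)) (M * ‖x‖ * ‖z‖)
    fun s => abs_re_apply_le ι (hM s) x z, fun s => key z _ (hGr s x)⟩, fun _ _ _ => rfl⟩

theorem Cr.ext {g h : Cr S} (H : ∀ s, g.1 s = h.1 s) : g = h :=
  Subtype.ext (BoundedContinuousFunction.ext H)

theorem exists_bound_of_submodule {V : Type*} [NormedAddCommGroup V] [NormedSpace ℝ V]
    (F : Submodule ℝ V) (ψ : F →L[ℝ] ℝ) : ∃ K, 0 ≤ K ∧ ∀ g : F, ‖ψ g‖ ≤ K * ‖(g : V)‖ :=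
  ⟨‖ψ‖, ψ.opNorm_nonneg, fun g => ψ.le_opNorm g⟩

theorem Cr.exists_bound (ψ : Cr S →L[ℝ] ℝ) : ∃ K, 0 ≤ K ∧ ∀ g : Cr S, ‖ψ g‖ ≤ K * ‖g.1‖ :=
  exists_bound_of_submodule (Cr S) ψ

namespace IsCoefficient

variable {f : X → Z → Cr S}

theorem add_left (hf : IsCoefficient ι G f) (x y : X) (z : Z) :
    f (x + y) z = f x z + f y z :=
  Cr.ext fun s => by
    change _ = (f x z).1 s + (f y z).1 s
    simp [hf _ _ s]

theorem add_right (hf : IsCoefficient ι G f) (x : X) (z w : Z) :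
    f x (z + w) = f x z + f x w :=
  Cr.ext fun s => by
    change _ = (f x z).1 s + (f x w).1 s
    simp [hf _ _ s]

theorem smul_right (hf : IsCoefficient ι G f) (x : X) (c : ℝ) (z : Z) :
    f x ((c : 𝕜) • z) = c • f x z :=
  Cr.ext fun s => by
    change _ = c * (f x z).1 s
    simp [hf _ _ s]

/-- The mean is only real-linear; moving a scalar of `𝕜` from `x` to `z` is what makes the average
`𝕜`-linear. -/
theorem smul_comm (hf : IsCoefficient ι G f) (c : 𝕜) (x : X) (z : Z) :
    f (c • x) z = f x (c • z) :=
  Cr.ext fun s => by simp [hf _ _ s]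

theorem norm_le (hf : IsCoefficient ι G f) (hM : ∀ s, ‖G s‖ ≤ M) (hM0 : 0 ≤ M) (x : X) (z : Z) :
    ‖(f x z).1‖ ≤ M * ‖x‖ * ‖z‖ := by
  refine (BoundedContinuousFunction.norm_le (by positivity)).2 fun s => ?_
  rw [hf]
  exact abs_re_apply_le ι (hM s) x z

theorem continuous_uncurry (hf : IsCoefficient ι G f) (hM : ∀ s, ‖G s‖ ≤ M) (hM0 : 0 ≤ M) :
    Continuous fun p : X × Z => f p.1 p.2 := by
  refine continuous_induced_rng.2 ?_
  change Continuous fun p : X × Z => (f p.1 p.2).1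
  rw [continuous_iff_continuousAt]
  intro a
  rw [ContinuousAt, tendsto_iff_norm_sub_tendsto_zero]
  have hlim : Tendsto (fun p : X × Z => M * ‖p.1 - a.1‖ * ‖p.2‖ + M * ‖a.1‖ * ‖p.2 - a.2‖)
      (𝓝 a) (𝓝 0) := by
    have : Continuous fun p : X × Z => M * ‖p.1 - a.1‖ * ‖p.2‖ + M * ‖a.1‖ * ‖p.2 - a.2‖ := by
      fun_prop
    simpa using this.tendsto a
  refine squeeze_zero (fun _ => norm_nonneg _) (fun p => ?_) hlim
  have : (f p.1 p.2).1 - (f a.1 a.2).1 = (f (p.1 - a.1) p.2).1 + (f a.1 (p.2 - a.2)).1 := by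
    ext s
    simp [hf _ _ s]
  rw [this]
  exact (norm_add_le _ _).trans (add_le_add (hf.norm_le hM hM0 _ _) (hf.norm_le hM hM0 _ _))

/-- An invariant mean on a space containing all coefficients averages the operator family. -/
theorem exists_average [Nonempty S] (hf : IsCoefficient ι G f) (hM : ∀ s, ‖G s‖ ≤ M) (hM0 : 0 ≤ M)
    {F : Submodule ℝ (Cr S)} {φ : F →ₗ[ℝ] ℝ} (hφ : IsMean F φ) (hmem : ∀ x z, f x z ∈ F) :
    ∃ T : X →L[𝕜] Y, ∀ x z, RCLike.re (ι (T x) z) = φ ⟨f x z, hmem x z⟩ := by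
  have H : ∀ x, ∃ h : StrongDual 𝕜 Z, (∀ z, RCLike.re (h z) = φ ⟨f x z, hmem x z⟩) ∧
      ‖h‖ ≤ M * ‖x‖ := fun x => by
    refine exists_strongDual_re_eq (fun z => φ ⟨f x z, hmem x z⟩) (fun z w => ?_) (fun c z => ?_)
      (M * ‖x‖) (by positivity) fun z => hφ.abs_apply_le _ _ fun s => ?_
    · rw [← map_add]
      exact congrArg φ (Subtype.ext (hf.add_right x z w))
    · rw [← smul_eq_mul, ← map_smul]
      exact congrArg φ (Subtype.ext (hf.smul_right x c z))
    · rw [hf]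
      exact abs_re_apply_le ι (hM s) x z
  choose h hh hnorm using H
  let T : X →ₗ[𝕜] Y :=
    { toFun := fun x => ι.symm (h x)
      map_add' := fun x y => by
        rw [← map_add]
        refine congrArg _ (strongDual_ext_re fun z => ?_)
        rw [add_apply, map_add, hh, hh, hh, ← map_add]
        exact congrArg φ (Subtype.ext (hf.add_left x y z))
      map_smul' := fun c x => by
        rw [RingHom.id_apply, ← map_smul]
        refine congrArg _ (strongDual_ext_re fun z => ?_)
        rw [smul_apply, ← map_smul, hh, hh]
        exact congrArg φ (Subtype.ext (hf.smul_comm c x z)) }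
  refine ⟨T.mkContinuous M fun x => ?_, fun x z => ?_⟩
  · change ‖ι.symm (h x)‖ ≤ _
    rw [ι.symm.norm_map]
    exact hnorm x
  · change RCLike.re (ι (ι.symm (h x)) z) = _
    rw [ι.apply_symm_apply, hh]

section Translation

variable {A : S → X →L[𝕜] X} {R : S → Y →L[𝕜] Y} {D : S → Z → Z}

theorem rightTranslate_eq (hf : IsCoefficient ι G f)
    (hG : ∀ t s x, G (t * s) x = R s (G t (A s x)))
    (hD : ∀ s y z, ι (R s y) z = ι y (D s z)) (s : S) (x : X) (z : Z) :
    rightTranslate s (f x z) = f (A s x) (D s z) :=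
  Cr.ext fun t => by rw [rightTranslate_apply, hf, hf, hG, hD]

theorem mem_CNorm (hf : IsCoefficient ι G f) (hM : ∀ s, ‖G s‖ ≤ M) (hM0 : 0 ≤ M)
    (hG : ∀ t s x, G (t * s) x = R s (G t (A s x)))
    (hD : ∀ s y z, ι (R s y) z = ι y (D s z)) (hA : Continuous A) (hR : Continuous R)
    (x : X) (z : Z) : f x z ∈ CNorm S := by
  have key : ∀ x z, Continuous fun s => rightTranslate s (f x z) := fun x z => by
    simp only [hf.rightTranslate_eq hG hD]
    exact (hf.continuous_uncurry hM hM0).comp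
      ((hA.clm_apply continuous_const).prodMk (continuous_preadjoint ι hD hR z))
  refine ⟨key x z, fun t => ?_⟩
  -- Translating by `t` first yields another coefficient, so this case reduces to `key`.
  simp only [← rightTranslate_rightTranslate, hf.rightTranslate_eq hG hD t]
  exact key _ _

/-- Here `s ↦ R s` is only strongly continuous, so `D s z` is handled through functionals: for fixed
`x`, `w ↦ ψ (f x w)` is the real part of the pairing with some `y : Y`, and `⟨y, D s z⟩ = ⟨R s y,
z⟩` is continuous in `s`. -/
theorem mem_CWeak (hf : IsCoefficient ι G f) (hM : ∀ s, ‖G s‖ ≤ M) (hM0 : 0 ≤ M)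
    (hG : ∀ t s x, G (t * s) x = R s (G t (A s x)))
    (hD : ∀ s y z, ι (R s y) z = ι y (D s z)) (hA : SOTContinuous A) (hR : SOTContinuous R)
    (hRb : LocallyBounded fun s => ‖R s‖) (x : X) (z : Z) : f x z ∈ CWeak S := by
  have key : ∀ x z, Continuous fun s => toWeakSpace ℝ (Cr S) (rightTranslate s (f x z)) :=
    fun x z => by
    refine WeakBilin.continuous_of_continuous_eval _ fun ψ => ?_
    change Continuous fun s => ψ (rightTranslate s (f x z))
    simp only [hf.rightTranslate_eq hG hD]
    refine continuous_iff_continuousAt.2 fun a => ?_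
    obtain ⟨C, hC⟩ := hRb.exists_eventually_norm_le a
    obtain ⟨K, hK0, hK⟩ := Cr.exists_bound ψ
    obtain ⟨h, hh, -⟩ := exists_strongDual_re_eq (𝕜 := 𝕜) (fun w => ψ (f (A a x) w))
      (fun v w => by rw [hf.add_right, map_add])
      (fun c w => by rw [hf.smul_right, map_smul, smul_eq_mul])
      (K * (M * ‖A a x‖)) (by positivity) fun w => by
        rw [mul_assoc]
        exact (hK _).trans (by gcongr; exact hf.norm_le hM hM0 _ _)
    obtain ⟨y, rfl⟩ := ι.surjective h
    -- The first term tends to `0` since `A s x → A a x` and `‖D s z‖` stays bounded near `a`.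
    have hsum : ∀ s, ψ (f (A s x) (D s z)) =
        ψ (f (A s x - A a x) (D s z)) + RCLike.re (ι (R s y) z) := fun s => by
      rw [hD, hh, ← map_add, ← hf.add_left, sub_add_cancel]
    have h2 : Continuous fun s => RCLike.re (ι (R s y) z) :=
      RCLike.continuous_re.comp ((ContinuousLinearMap.apply 𝕜 𝕜 z).continuous.comp
        (ι.continuous.comp (hR y)))
    have h1 : Tendsto (fun s => ψ (f (A s x - A a x) (D s z))) (𝓝 a) (𝓝 0) := by
      have hlim : Tendsto (fun s => K * (M * ‖A s x - A a x‖ * (C * ‖z‖))) (𝓝 a) (𝓝 0) := by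
        have hAx := hA x
        have : Continuous fun s => K * (M * ‖A s x - A a x‖ * (C * ‖z‖)) := by fun_prop
        simpa using this.tendsto a
      refine squeeze_zero_norm' ?_ hlim
      filter_upwards [hC] with s hs
      refine (hK _).trans (mul_le_mul_of_nonneg_left ((hf.norm_le hM hM0 _ _).trans ?_) hK0)
      gcongr
      exact (norm_preadjoint_le ι (R s) z (D s z) fun y => hD s y z).trans (by gcongr)
    have h3 := h1.add (h2.tendsto a)
    simp only [← hsum, zero_add] at h3
    have ha := hsum a
    simp only [sub_self] at ha
    have h0 : ψ (f 0 (D a z)) = 0 := by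
      have : f 0 (D a z) = 0 := Cr.ext fun s => by
        rw [hf, map_zero, map_zero]
        exact map_zero RCLike.re
      rw [this, map_zero]
    rw [h0, zero_add] at ha
    rw [← ha] at h3
    exact h3
  refine ⟨key x z, fun t => ?_⟩
  simp only [← rightTranslate_rightTranslate, hf.rightTranslate_eq hG hD t]
  exact key _ _

end Translation

end IsCoefficient

end Coefficients

end SGT

/-! ### The equivalence. -/

theorem mainTheorem3 {𝕜 : Type*} [RCLike 𝕜]
    {S : Type*} [Semigroup S] [TopologicalSpace S] [Nonempty S]
    {X : Type*} [NormedAddCommGroup X] [NormedSpace 𝕜 X] [CompleteSpace X]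
    {Y : Type*} [NormedAddCommGroup Y] [NormedSpace 𝕜 Y] [CompleteSpace Y]
    -- `Y` is a dual Banach space: it is linearly isometric to the dual of a Banach space `Z`
    {Z : Type*} [NormedAddCommGroup Z] [NormedSpace 𝕜 Z] [CompleteSpace Z]
    (ι : Y ≃ₗᵢ[𝕜] StrongDual 𝕜 Z)
    (A : S →ₙ* (X →L[𝕜] X)) (B : S →ₙ* (Y →L[𝕜] Y))
    -- the strong and the weak version, with the corresponding continuity of `A` and `B`
    (hS : (SGT.StronglyRightAmenable S ∧ SGT.SOTContinuous A ∧ SGT.SOTContinuous B) ∨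
      (SGT.WeaklyRightAmenable S ∧ Continuous A ∧ Continuous B))
    (E : Submodule 𝕜 X) (hE : IsClosed (E : Set X)) (T₀ : E →L[𝕜] Y)
    (hAE : ∀ s : S, ∀ x ∈ E, A s x ∈ E)
    (hB : ∀ s : S, (B s).IsInvertible)
    (hBw : ∀ s : S, SGT.WeakStarContinuousOnBall ι (B s))
    (hBinv : SGT.LocallyBounded fun s : S => ‖(B s).inverse‖)
    (hT₀ : ∀ (s : S) (x : E), B s (T₀ x) = T₀ ⟨A s x, hAE s x x.2⟩) :
    (∃ T : X →L[𝕜] Y, (∀ x : E, T x = T₀ x) ∧ ∀ s : S, (B s) ∘L T = T ∘L (A s)) ↔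
      ∃ T' : X →L[𝕜] Y, (∀ x : E, T' x = T₀ x) ∧
        BddAbove (Set.range fun s : S => ‖(B s).inverse ∘L T' ∘L (A s)‖) := by
  have hBR : ∀ s y, B s ((B s).inverse y) = y := fun s y =>
    ((hB s).inverse_apply_eq.1 rfl).symm
  have hRB : ∀ s y, (B s).inverse (B s y) = y := fun s y => (hB s).inverse_apply_eq.2 rfl
  constructor
  · rintro ⟨T, hT, hcomm⟩
    refine ⟨T, hT, ‖T‖, ?_⟩
    rintro _ ⟨s, rfl⟩
    have : (B s).inverse ∘L T ∘L (A s) = T := by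
      rw [← hcomm]
      ext x
      exact hRB s _
    exact (congrArg norm this).le
  rintro ⟨T', hT', M, hM⟩
  let R : S → Y →L[𝕜] Y := fun s => (B s).inverse
  let G : S → X →L[𝕜] Y := fun s => R s ∘L T' ∘L A s
  have hGM : ∀ s, ‖G s‖ ≤ M := fun s => hM ⟨s, rfl⟩
  have hM0 : 0 ≤ M := (norm_nonneg _).trans (hGM (Classical.arbitrary S))
  have hAc : SGT.SOTContinuous A := by
    rcases hS with h | h
    · exact h.2.1
    · exact fun x => h.2.1.clm_apply continuous_const
  have hBc : SGT.SOTContinuous B := by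
    rcases hS with h | h
    · exact h.2.2
    · exact fun x => h.2.2.clm_apply continuous_const
  have hRc : ∀ v : S → Y, Continuous v → Continuous fun s => R s (v s) := fun v hv =>
    SGT.continuous_inverse_apply hBc hRB hBR hBinv hv
  -- Inversion reverses `B_{ts} = B_t B_s`, so the factor of `s` ends up outermost on both sides of
  -- `G t`.
  have hG : ∀ t s x, G (t * s) x = R s (G t (A s x)) := fun t s x => by
    refine (hB (t * s)).inverse_apply_eq.2 ?_
    rw [map_mul, map_mul]
    change T' (A t (A s x)) = B t (B s (R s (R t (T' (A t (A s x))))))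
    rw [hBR, hBR]
  have hGc : ∀ x, Continuous fun s => G s x := fun x =>
    hRc _ (T'.continuous.comp (hAc x))
  have hGr : ∀ s x, Continuous fun t => G (t * s) x := fun s x => by
    simp only [hG]
    exact (R s).continuous.comp (hGc _)
  obtain ⟨f, hf⟩ := SGT.exists_isCoefficient ι hGM hGc hGr
  choose D hD using fun s => SGT.exists_preadjoint_inverse ι (B s) (hBw s) (hB s)
  obtain ⟨F, hF, φ, hφ, hmem⟩ : ∃ (F : Submodule ℝ (SGT.Cr S)) (hF : SGT.RightInvariant F)
      (φ : F →ₗ[ℝ] ℝ), SGT.IsRightInvariantMean F hF φ ∧ ∀ x z, f x z ∈ F := by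
    rcases hS with ⟨⟨φ, hφ⟩, -, -⟩ | ⟨⟨φ, hφ⟩, hA, hB'⟩
    · exact ⟨_, _, φ, hφ, hf.mem_CWeak hGM hM0 hG hD hAc (fun y => hRc _ continuous_const) hBinv⟩
    · exact ⟨_, _, φ, hφ, hf.mem_CNorm hGM hM0 hG hD hA
        (SGT.continuous_inverse hB' hRB hBR hBinv)⟩
  obtain ⟨T, hT⟩ := hf.exists_average hGM hM0 hφ.1 hmem
  refine ⟨T, fun x => ι.injective (SGT.strongDual_ext_re fun z => ?_), fun s => ?_⟩
  · rw [hT]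
    refine hφ.1.eq_of_forall_eq _ _ fun s => ?_
    -- On `E`, `T' A_s x = T₀ A_s x = B_s T₀ x`, so `G s x` does not depend on `s`.
    have hGx : G s x = T₀ x := by
      refine (hB s).inverse_apply_eq.2 ?_
      rw [hT₀, ← hT']
      rfl
    rw [hf, hGx]
  · ext x
    have hTA : R s (T (A s x)) = T x :=
      ι.injective (SGT.strongDual_ext_re fun z => by
        rw [hD, hT, hT, ← hφ.2 ⟨f x z, hmem x z⟩ s]
        exact congrArg φ (Subtype.ext (hf.rightTranslate_eq hG hD s x z).symm))
    change B s (T x) = T (A s x)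
    rw [← hTA, hBR]
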